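/- Let $\mathbb{S}$ be the Sorgenfrey line, that is, the set $\mathbb{R}$ with the topology generated by the base $\{[a,b) : a<b\}$, and let $\mathbb{S}^\omega=\prod_{i\in\omega}\mathbb{S}$ be its countable power with the product topology. A topological space $X$ is called a D-space if, for every function $\varphi$ that assigns to each point $p\in X$ an open set $\varphi(p)\subseteq X$ with $p\in\varphi(p)$, there is a closed discrete set $D\subseteq X$ (discrete: every $q\in D$ has an open neighbourhood $O$ in $X$ with $O\cap D=\{q\}$) such that $\bigcup_{p\in D}\varphi(p)=X$. Theorem. The countable power $\mathbb{S}^\omega$ of the Sorgenfrey line is a D-space. -/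

import Mathlib

/-- The Sorgenfrey line: a copy of the real line that carries the topology generated by the
half-open intervals `[a, b)` instead of the Euclidean one. -/
def SorgenfreyLine : Type := ℝ

namespace SorgenfreyLine

/-- The usual order of the real numbers. -/
noncomputable instance instLinearOrder : LinearOrder SorgenfreyLine :=
  inferInstanceAs (LinearOrder ℝ)

/-- The topology generated by the half-open intervals `[a, b)` with `a < b`. -/
instance instTopologicalSpace : TopologicalSpace SorgenfreyLine :=
  TopologicalSpace.generateFrom {s | ∃ a b : SorgenfreyLine, a < b ∧ s = Set.Ico a b}

end SorgenfreyLine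

/-- A neighbourhood assignment for `X`: every `φ p` is an open set that contains `p`. -/
def IsNeighbourhoodAssignment {X : Type*} [TopologicalSpace X] (φ : X → Set X) : Prop :=
  ∀ p : X, IsOpen (φ p) ∧ p ∈ φ p

/-- `X` is a D-space: for every neighbourhood assignment `φ` there is a closed discrete subset `D`
of `X` such that the sets `φ p`, `p ∈ D`, cover `X`. -/
def IsDSpace (X : Type*) [TopologicalSpace X] : Prop :=
  ∀ φ : X → Set X, IsNeighbourhoodAssignment φ →
    ∃ D : Set X, IsClosed D ∧ IsDiscrete D ∧ ⋃ p ∈ D, φ p = Set.univ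

/-!
Fix a neighbourhood assignment `φ` on the countable power of the Sorgenfrey line, and call a closed
set coverable if it is covered by the neighbourhoods of the points of a closed discrete subset of
it. It is to be shown that the whole space is coverable.

*Descent.* A closed set that is not coverable contains, for each `m`, another one on which the
first `m` coordinates are constant (`exists_not_coverable_subset`). Iterating, one obtains a
decreasing sequence of closed sets that are not coverable and that shrink to a point `p` lying in
all of them; but then `φ p` alone covers one of them (`coverable_univ`).

*A covering game.* For the descent step, the space is split into countably many sets `A`, for each
of which there is a finite set `N ⊇ {0, …, m - 1}` of coordinates such that `φ x` contains all
points of `A` that are above `x ∈ A` in the coordinates in `N`. Closed sets that are unions of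
countably many thin sets (`Thin`) are coverable (`coverable_of_thin`): a game of length `ω`, each
move of which is a closed discrete subset of what is still uncovered, gets rid of countably many
thin sets. So it is enough that `A` is thin in a closed set all of whose fibres over the
coordinates in `N` are coverable (`thin_of_cone`).

*Thinness.* The induction in `thin_of_cone` is on the number of coordinates in `N` that are not yet
constant. Let `K` be the set of these, and let `Y` be the projection of the uncovered part of `A`
to `K`.

* Well-founded subsets of a finite power of the Sorgenfrey line have no accumulation points
  (`hasNoAcc_of_isWF`). This makes it possible to cover, in one move, the fibres over all the
  minimal points of the closure of `Y` (`exists_cover_fibres_minimal`).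
* Some points of `A` that project to points `y` for which the volume of the box between `y` and a
  rational point `q` is almost maximal then cover every `x ∈ A` whose projection strictly exceeds
  a point of `Y` in all coordinates. Such near-maximal points can accumulate only at a minimal point
  of the closure of `Y` (`exists_subset_finite_above`), where the fibre is covered, so that they
  form a closed discrete set (`exists_cover_no_strict_pair`).
* For the remaining points there is a nonempty minimal set `J ⊆ K` of coordinates in which the
  point agrees with a point of `Y` that it exceeds in the other coordinates. Sorting by `J` and by a
  rational point in between yields countably many sets whose projections to `J` are antichains.
  On each slice at least one more coordinate is constant, and the slices form a discrete
  family, so the induction hypothesis applies.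
-/

open Set Filter Topology

/-! ### Sets without accumulation points and the sets they cover -/

section Thin

variable {X : Type*}

/-- The union of the neighbourhoods that `φ` assigns to the points of `D`. -/
def cov (φ : X → Set X) (D : Set X) : Set X := ⋃ p ∈ D, φ p

theorem mem_cov {φ : X → Set X} {D : Set X} {x : X} : x ∈ cov φ D ↔ ∃ p ∈ D, x ∈ φ p := by
  simp [cov]

theorem cov_mono {φ : X → Set X} {D E : Set X} (h : D ⊆ E) : cov φ D ⊆ cov φ E :=
  biUnion_subset_biUnion_left h

variable [TopologicalSpace X]

/-- `D` has no accumulation point in `X`; this says that `D` is closed and discrete. -/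
def HasNoAcc (D : Set X) : Prop := ∀ x, ∀ᶠ y in 𝓝 x, y ∈ D → y = x

/-- `F` is covered by the neighbourhoods of the points of a closed discrete subset of `F`. -/
def Coverable (φ : X → Set X) (F : Set X) : Prop := ∃ D ⊆ F, HasNoAcc D ∧ F ⊆ cov φ D

theorem HasNoAcc.mono {D E : Set X} (hE : HasNoAcc E) (h : D ⊆ E) : HasNoAcc D :=
  fun x => (hE x).mono fun _ hy hD => hy (h hD)

theorem HasNoAcc.union {D E : Set X} (hD : HasNoAcc D) (hE : HasNoAcc E) : HasNoAcc (D ∪ E) := by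
  intro x
  filter_upwards [hD x, hE x] with y h1 h2 h
  exact h.elim h1 h2

theorem hasNoAcc_empty : HasNoAcc (∅ : Set X) := fun _ => Eventually.of_forall fun _ h => h.elim

theorem hasNoAcc_finite [T1Space X] {D : Set X} (hD : D.Finite) : HasNoAcc D := by
  intro x
  have : (D \ {x})ᶜ ∈ 𝓝 x := (hD.subset sdiff_subset).isClosed.isOpen_compl.mem_nhds (by simp)
  filter_upwards [this] with y hy hD
  by_contra h
  exact hy ⟨hD, h⟩

theorem HasNoAcc.isClosed {D : Set X} (hD : HasNoAcc D) : IsClosed D := by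
  rw [← isOpen_compl_iff, isOpen_iff_mem_nhds]
  intro x hx
  filter_upwards [hD x] with y hy hyD
  exact hx (hy hyD ▸ hyD)

theorem HasNoAcc.isDiscrete {D : Set X} (hD : HasNoAcc D) : IsDiscrete D := by
  rw [isDiscrete_iff_forall_mem_exists_isOpen]
  intro x hx
  obtain ⟨u, hu, huo, hxu⟩ := mem_nhds_iff.1 (hD x)
  refine ⟨u, huo, ?_⟩
  ext y
  constructor
  · rintro ⟨h1, h2⟩
    exact hu h1 h2
  · rintro rfl
    exact ⟨hxu, hx⟩

theorem isOpen_cov {φ : X → Set X} (hφ : IsNeighbourhoodAssignment φ) (D : Set X) :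
    IsOpen (cov φ D) :=
  isOpen_biUnion fun p _ => (hφ p).1

/-- Sets without accumulation points that lie in the fibres of a continuous map over the points of
a set `T` glue together if `T` itself has no accumulation point. -/
theorem HasNoAcc.of_fibres {Z : Type*} [TopologicalSpace Z] {p : X → Z} (hp : Continuous p)
    {T : Set Z} (hT : HasNoAcc T) {D : Set X} (hDT : ∀ d ∈ D, p d ∈ T)
    (hD : ∀ t, HasNoAcc (D ∩ p ⁻¹' {t})) : HasNoAcc D := by
  intro x
  filter_upwards [hp.continuousAt (hT (p x)), hD (p x) x] with y h1 h2 hy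
  exact h2 ⟨hy, h1 (hDT y hy)⟩

/-! ### Thin sets -/

/-- Sets that can be covered in a game of countable length. The only thin set of rank `0` is the
empty set. A set `A` is thin of rank `n + 1` if, whatever closed set `F` is still to be covered,
one closed discrete subset of `F` covers `A ∩ F` up to countably many thin sets of rank `n`. -/
def Thin (φ : X → Set X) : ℕ → Set X → Prop
  | 0, A => A = ∅
  | n + 1, A => ∀ F, IsClosed F → ∃ D ⊆ F, HasNoAcc D ∧ ∃ B : ℕ → Set X,
      (∀ m, Thin φ n (B m)) ∧ A ∩ F ⊆ cov φ D ∪ ⋃ m, B m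

variable {φ : X → Set X}

theorem Thin.mono {n : ℕ} {A A' : Set X} (hA : Thin φ n A) (h : A' ⊆ A) : Thin φ n A' := by
  cases n with
  | zero =>
    rw [Thin] at hA ⊢
    exact subset_empty_iff.1 (hA ▸ h)
  | succ n =>
    intro F hF
    obtain ⟨D, hDF, hD, B, hB, hc⟩ := hA F hF
    exact ⟨D, hDF, hD, B, hB, (inter_subset_inter_left F h).trans hc⟩

theorem thin_empty (n : ℕ) : Thin φ n (∅ : Set X) := by
  induction n with
  | zero => rfl
  | succ n ih =>
    exact fun F _ => ⟨∅, empty_subset F, hasNoAcc_empty, fun _ => ∅, fun _ => ih, by simp⟩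

/-- Countably many thin sets may be left over, for any countable index type. -/
theorem thin_succ_of_countable {n : ℕ} {A : Set X}
    (h : ∀ F, IsClosed F → ∃ D ⊆ F, HasNoAcc D ∧ ∃ (ι : Type) (_ : Countable ι) (B : ι → Set X),
      (∀ m, Thin φ n (B m)) ∧ A ∩ F ⊆ cov φ D ∪ ⋃ m, B m) : Thin φ (n + 1) A := by
  intro F hF
  obtain ⟨D, hDF, hD, ι, _, B, hB, hc⟩ := h F hF
  rcases isEmpty_or_nonempty ι with hι | hι
  · exact ⟨D, hDF, hD, fun _ => ∅, fun _ => thin_empty n, by simpa using hc⟩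
  · obtain ⟨f, hf⟩ := exists_surjective_nat ι
    exact ⟨D, hDF, hD, B ∘ f, fun m => hB _, by
      simpa only [Function.comp_apply, hf.iUnion_comp B] using hc⟩

theorem Thin.split {n : ℕ} {A F : Set X} (hA : Thin φ n A) (hF : IsClosed F) :
    ∃ D ⊆ F, HasNoAcc D ∧ ∃ B : ℕ → Set X,
      (∀ m, Thin φ (n - 1) (B m)) ∧ A ∩ F ⊆ cov φ D ∪ ⋃ m, B m := by
  cases n with
  | zero =>
    rw [Thin] at hA
    exact ⟨∅, empty_subset F, hasNoAcc_empty, fun _ => ∅, fun _ => thin_empty 0, by simp [hA]⟩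
  | succ n => exact hA F hF

/-- Thin pieces over the points of a set without accumulation points glue to a thin set. -/
theorem Thin.of_fibres {Z : Type*} [TopologicalSpace Z] [T1Space Z] {p : X → Z}
    (hp : Continuous p) {T : Set Z} (hT : HasNoAcc T) {n : ℕ} {A : Set X}
    (hAT : ∀ x ∈ A, p x ∈ T) (hA : ∀ t, Thin φ n (A ∩ p ⁻¹' {t})) : Thin φ n A := by
  induction n generalizing A with
  | zero =>
    rw [Thin, eq_empty_iff_forall_notMem]
    intro x hx
    have := hA (p x)
    rw [Thin, eq_empty_iff_forall_notMem] at this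
    exact this x ⟨hx, rfl⟩
  | succ n ih =>
    intro F hF
    have key : ∀ t, ∃ D ⊆ F ∩ p ⁻¹' {t}, HasNoAcc D ∧ ∃ B : ℕ → Set X,
        (∀ m, Thin φ n (B m)) ∧ (A ∩ p ⁻¹' {t}) ∩ (F ∩ p ⁻¹' {t}) ⊆ cov φ D ∪ ⋃ m, B m :=
      fun t => hA t _ (hF.inter (isClosed_singleton.preimage hp))
    choose D hDF hD B hB hc using key
    have hfib : ∀ C : Z → Set X, (∀ t, C t ⊆ p ⁻¹' {t}) → ∀ t,
        (⋃ s ∈ T, C s) ∩ p ⁻¹' {t} ⊆ C t := by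
      rintro C hC t x ⟨hx, rfl⟩
      obtain ⟨s, -, hs⟩ := mem_iUnion₂.1 hx
      have : p x = s := hC s hs
      rwa [this]
    have hDp : ∀ t, D t ⊆ p ⁻¹' {t} := fun t => (hDF t).trans inter_subset_right
    refine ⟨⋃ t ∈ T, D t, iUnion₂_subset fun t _ => (hDF t).trans inter_subset_left,
      HasNoAcc.of_fibres hp hT ?_ fun t => (hD t).mono (hfib D hDp t),
      fun m => ⋃ t ∈ T, B t m ∩ p ⁻¹' {t}, fun m => ih ?_ fun t =>
        (hB t m).mono ((hfib (fun t => B t m ∩ p ⁻¹' {t}) (fun t => inter_subset_right) t).trans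
          inter_subset_left), ?_⟩
    · intro d hd
      obtain ⟨t, ht, hdt⟩ := mem_iUnion₂.1 hd
      rwa [show p d = t from hDp t hdt]
    · intro d hd
      obtain ⟨t, ht, hdt⟩ := mem_iUnion₂.1 hd
      rwa [show p d = t from hdt.2]
    · rintro x ⟨hxA, hxF⟩
      rcases hc (p x) ⟨⟨hxA, rfl⟩, hxF, rfl⟩ with h | h
      · exact Or.inl (cov_mono (subset_biUnion_of_mem (u := D) (hAT x hxA)) h)
      · obtain ⟨m, hm⟩ := mem_iUnion.1 h
        exact Or.inr (mem_iUnion.2 ⟨m, mem_biUnion (hAT x hxA) ⟨hm, rfl⟩⟩)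

/-- A closed set that is covered by countably many thin sets, of whatever ranks, is coverable:
a play of length `ω` deals with every thin set that is given or left over on the way. Row `k + 1`
of the bookkeeping table holds the thin sets left over at time `k`, and the entry `(i, m)` of the
table is dealt with at time `Nat.pair i m ≥ i`. -/
theorem coverable_of_thin (hφ : IsNeighbourhoodAssignment φ) {F : Set X} (hF : IsClosed F)
    {l : ℕ → ℕ} {A : ℕ → Set X} (hA : ∀ k, Thin φ (l k) (A k)) (hFA : F ⊆ ⋃ k, A k) :
    Coverable φ F := by
  let T := {a : ℕ × Set X // Thin φ a.1 a.2}
  let G := {F : Set X // IsClosed F}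
  have key : ∀ (t : T) (g : G), ∃ D ⊆ g.1, HasNoAcc D ∧ ∃ B : ℕ → T,
      (∀ m, (B m).1.1 = t.1.1 - 1) ∧ t.1.2 ∩ g.1 ⊆ cov φ D ∪ ⋃ m, (B m).1.2 := by
    rintro ⟨⟨n, A⟩, ht⟩ ⟨F, hF⟩
    obtain ⟨D, h1, h2, B, h3, h4⟩ := Thin.split ht hF
    exact ⟨D, h1, h2, fun m => ⟨(n - 1, B m), h3 m⟩, fun m => rfl, h4⟩
  choose D hDg hD B hB hc using key
  let entry : (ℕ → ℕ → T) → ℕ → T := fun r k => r k.unpair.1 k.unpair.2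
  let σ : ℕ → G × (ℕ → ℕ → T) := fun k => Nat.rec (⟨F, hF⟩, fun _ m => ⟨(l m, A m), hA m⟩)
    (fun k s => (⟨s.1.1 \ cov φ (D (entry s.2 k) s.1), s.1.2.sdiff (isOpen_cov hφ _)⟩,
      Function.update s.2 (k + 1) (B (entry s.2 k) s.1))) k
  have hrow : ∀ k i, i ≤ k → (σ k).2 i = (σ i).2 i := by
    intro k
    induction k with
    | zero => intro i hi; rw [Nat.le_zero.1 hi]
    | succ k ih =>
      intro i hi
      rcases hi.eq_or_lt with rfl | hi
      · rfl
      · rw [← ih i (Nat.lt_succ_iff.1 hi)]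
        exact Function.update_of_ne hi.ne _ _
  let t : ℕ → T := fun k => entry (σ k).2 k
  let E : ℕ → Set X := fun k => D (t k) (σ k).1
  have ht : ∀ i m, t (Nat.pair i m) = (σ i).2 i m := by
    intro i m
    have : t (Nat.pair i m) = (σ (Nat.pair i m)).2 i m := by simp [t, entry]
    rw [this, hrow _ _ (Nat.left_le_pair i m)]
  have hstep : ∀ k, (σ (k + 1)).1.1 = (σ k).1.1 \ cov φ (E k) := fun k => rfl
  have hnext : ∀ k, (σ (k + 1)).2 (k + 1) = B (t k) (σ k).1 := fun k => Function.update_self ..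
  have hanti : ∀ j k, j ≤ k → (σ k).1.1 ⊆ (σ j).1.1 := by
    intro j k h
    induction h with
    | refl => exact subset_rfl
    | step _ ih => exact (hstep _ ▸ sdiff_subset).trans ih
  have hrem : ∀ x ∈ F, (∀ k, x ∉ cov φ (E k)) → ∀ k, x ∈ (σ k).1.1 := by
    intro x hx h k
    induction k with
    | zero => exact hx
    | succ k ih => rw [hstep]; exact ⟨ih, h k⟩
  have hcov : ∀ x ∈ F, ∃ k, x ∈ cov φ (E k) := by
    intro x hx
    by_contra! hno
    have hrem := hrem x hx hno
    have hnot : ∀ n i m, ((σ i).2 i m).1.1 = n → x ∉ ((σ i).2 i m).1.2 := by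
      intro n
      induction n with
      | zero =>
        intro i m hn hxm
        have := ((σ i).2 i m).2
        rw [hn, Thin] at this
        rw [this] at hxm
        exact hxm
      | succ n ih =>
        intro i m hn hxm
        rw [← ht i m] at hn hxm
        rcases hc _ (σ (Nat.pair i m)).1 ⟨hxm, hrem _⟩ with h | h
        · exact hno _ h
        · obtain ⟨m', hm'⟩ := mem_iUnion.1 h
          refine ih (Nat.pair i m + 1) m' ?_ ?_
          · rw [hnext, hB, hn, Nat.add_sub_cancel]
          · rwa [hnext]
    obtain ⟨k, hk⟩ := mem_iUnion.1 (hFA hx)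
    exact hnot _ 0 k rfl hk
  have hEF : ∀ k, E k ⊆ F := fun k => (hDg _ _).trans (hanti 0 k k.zero_le)
  refine ⟨⋃ k, E k, iUnion_subset hEF, ?_, fun x hx => ?_⟩
  · intro x
    by_cases hx : x ∈ F
    · obtain ⟨k, hk⟩ := hcov x hx
      -- beyond time `k` no point is chosen in the neighbourhood covered at time `k`
      have hfin : ∀ᶠ y in 𝓝 x, ∀ j ∈ Finset.range (k + 1), y ∈ E j → y = x :=
        (Finset.eventually_all _).2 fun j _ => hD _ _ x
      filter_upwards [hfin, (isOpen_cov hφ (E k)).mem_nhds hk] with y h1 h2 hy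
      obtain ⟨j, hj⟩ := mem_iUnion.1 hy
      rcases Nat.lt_or_ge k j with hkj | hkj
      · have := hanti (k + 1) j hkj (hDg _ _ hj)
        rw [hstep] at this
        exact absurd h2 this.2
      · exact h1 j (Finset.mem_range.2 (Nat.lt_succ_of_le hkj)) hj
    · filter_upwards [hF.isOpen_compl.mem_nhds hx] with y h1 hy
      exact absurd (iUnion_subset hEF hy) h1
  · obtain ⟨k, hk⟩ := hcov x hx
    exact cov_mono (subset_iUnion E k) hk

end Thin

/-! ### The Sorgenfrey line and its powers -/

namespace SorgenfreyLine

/-- The underlying real number. -/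
def toReal (x : SorgenfreyLine) : ℝ := x

theorem toReal_lt {x y : SorgenfreyLine} : x.toReal < y.toReal ↔ x < y := Iff.rfl

theorem toReal_le {x y : SorgenfreyLine} : x.toReal ≤ y.toReal ↔ x ≤ y := Iff.rfl

theorem exists_toReal (r : ℝ) : ∃ x : SorgenfreyLine, x.toReal = r := ⟨r, rfl⟩

theorem isOpen_Ico (a b : SorgenfreyLine) : IsOpen (Ico a b) := by
  rcases lt_or_ge a b with h | h
  · exact TopologicalSpace.isOpen_generateFrom_of_mem ⟨a, b, h, rfl⟩
  · rw [Ico_eq_empty h.not_gt]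
    exact isOpen_empty

theorem isOpen_Ici (a : SorgenfreyLine) : IsOpen (Ici a) := by
  rw [show Ici a = ⋃ b, Ico a b from ?_]
  · exact isOpen_iUnion fun b => isOpen_Ico a b
  · ext x
    obtain ⟨b, hb⟩ := exists_toReal (x.toReal + 1)
    have : x < b := toReal_lt.1 (by linarith)
    simp only [mem_Ici, mem_iUnion, mem_Ico]
    exact ⟨fun h => ⟨b, h, this⟩, fun ⟨_, h, _⟩ => h⟩

theorem isOpen_Iio (b : SorgenfreyLine) : IsOpen (Iio b) := by
  rw [show Iio b = ⋃ a, Ico a b from ?_]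
  · exact isOpen_iUnion fun a => isOpen_Ico a b
  · ext x
    simp only [mem_Iio, mem_iUnion, mem_Ico]
    exact ⟨fun h => ⟨x, le_rfl, h⟩, fun ⟨_, _, h⟩ => h⟩

theorem continuous_toReal : Continuous toReal := by
  rw [OrderTopology.topology_eq_generate_intervals (α := ℝ), continuous_generateFrom_iff]
  rintro s ⟨a, rfl | rfl⟩
  · rw [isOpen_iff_mem_nhds]
    intro x hx
    filter_upwards [(isOpen_Ici x).mem_nhds self_mem_Ici] with y hy
    exact lt_of_lt_of_le hx (toReal_le.2 hy)
  · exact isOpen_Iio a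

instance : T1Space SorgenfreyLine :=
  ⟨fun x => by
    have : ({x} : Set SorgenfreyLine) = toReal ⁻¹' {x.toReal} := rfl
    rw [this]
    exact isClosed_singleton.preimage continuous_toReal⟩

theorem exists_Ico_subset {a : SorgenfreyLine} {s : Set SorgenfreyLine} (hs : s ∈ 𝓝 a) :
    ∃ b, a < b ∧ Ico a b ⊆ s := by
  obtain ⟨u, hus, hu, hau⟩ := mem_nhds_iff.1 hs
  suffices ∃ b, a < b ∧ Ico a b ⊆ u from this.imp fun b hb => ⟨hb.1, hb.2.trans hus⟩
  clear hs hus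
  induction hu with
  | basic v hv =>
    obtain ⟨c, d, -, rfl⟩ := hv
    exact ⟨d, hau.2, Ico_subset_Ico_left hau.1⟩
  | univ =>
    obtain ⟨b, hb⟩ := exists_toReal (a.toReal + 1)
    exact ⟨b, toReal_lt.1 (by linarith), subset_univ _⟩
  | inter v w _ _ hv hw =>
    obtain ⟨b, hb, hbv⟩ := hv hau.1
    obtain ⟨c, hc, hcw⟩ := hw hau.2
    exact ⟨min b c, lt_min hb hc, fun x hx =>
      ⟨hbv ⟨hx.1, hx.2.trans_le (min_le_left _ _)⟩, hcw ⟨hx.1, hx.2.trans_le (min_le_right _ _)⟩⟩⟩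
  | sUnion S _ ih =>
    obtain ⟨v, hv, hav⟩ := hau
    obtain ⟨b, hb, hbv⟩ := ih v hv hav
    exact ⟨b, hb, hbv.trans (subset_sUnion_of_mem hv)⟩

/-- A neighbourhood of `x` in the countable power contains all the points whose coordinates
with index below some `n` lie to the right of those of `x` by less than `1 / (n + 1)`. -/
theorem exists_box_subset {x : ℕ → SorgenfreyLine} {U : Set (ℕ → SorgenfreyLine)} (hU : U ∈ 𝓝 x) :
    ∃ n : ℕ, ∀ y : ℕ → SorgenfreyLine,
      (∀ i < n, x i ≤ y i ∧ (y i).toReal < (x i).toReal + 1 / (n + 1)) → y ∈ U := by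
  rw [nhds_pi, Filter.mem_pi] at hU
  obtain ⟨I, hI, t, ht, hU⟩ := hU
  have : ∀ i, ∃ m : ℕ, ∀ z : SorgenfreyLine,
      x i ≤ z → z.toReal < (x i).toReal + 1 / (m + 1) → z ∈ t i := by
    intro i
    obtain ⟨b, hb, hbt⟩ := exists_Ico_subset (ht i)
    obtain ⟨m, hm⟩ := exists_nat_one_div_lt (sub_pos.2 (toReal_lt.2 hb))
    exact ⟨m, fun z h1 h2 => hbt ⟨h1, toReal_lt.1 (by linarith)⟩⟩
  choose m hm using this
  obtain ⟨M, hM⟩ := (hI.image m).bddAbove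
  obtain ⟨N, hN⟩ := hI.bddAbove
  refine ⟨max M (N + 1), fun y hy => hU fun i hi => ?_⟩
  have hiN : i < max M (N + 1) := lt_of_lt_of_le (Nat.lt_succ_of_le (hN hi)) (le_max_right _ _)
  refine hm i _ (hy i hiN).1 ((hy i hiN).2.trans_le ?_)
  have : (m i : ℝ) ≤ ((max M (N + 1) : ℕ) : ℝ) :=
    Nat.cast_le.2 ((hM (mem_image_of_mem m hi)).trans (le_max_left _ _))
  gcongr

section FinitePower

variable {ι : Type*} [Finite ι]

theorem eventually_ge_pi (w : ι → SorgenfreyLine) : ∀ᶠ t in 𝓝 w, w ≤ t := by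
  simp only [Pi.le_def, eventually_all]
  exact fun i => (continuous_apply i).continuousAt ((isOpen_Ici (w i)).mem_nhds self_mem_Ici)

/-- A well-founded subset of a finite power of the Sorgenfrey line has no accumulation point:
near an accumulation point `w` some set of coordinates is that of the coordinates of infinitely
many points of the set that exceed those of `w`, and among such points there is no minimal one. -/
theorem hasNoAcc_of_isWF {T : Set (ι → SorgenfreyLine)} (hT : T.IsWF) : HasNoAcc T := by
  intro w
  have key : ∀ J : Set ι, ∀ᶠ t in 𝓝 w, t ∈ T → {i | w i < t i} = J → t = w := by
    intro J
    rcases J.eq_empty_or_nonempty with rfl | ⟨j, hj⟩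
    · filter_upwards [eventually_ge_pi w] with t ht _ h
      ext i
      exact le_antisymm (not_lt.1 fun hi => (h ▸ hi : i ∈ (∅ : Set ι))) (ht i)
    · let TJ : Set (ι → SorgenfreyLine) := {t ∈ T | w ≤ t ∧ {i | w i < t i} = J}
      rcases TJ.eq_empty_or_nonempty with h | h
      · filter_upwards [eventually_ge_pi w] with t ht htT htJ
        exact absurd (show t ∈ TJ from ⟨htT, ht, htJ⟩) (h ▸ notMem_empty t)
      · have hWF : TJ.IsWF := hT.mono fun t ht => ht.1
        obtain ⟨-, hws, hsJ⟩ := hWF.min_mem h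
        set s := hWF.min h
        have hlt : ∀ᶠ t in 𝓝 w, ∀ i, i ∈ J → t i < s i := by
          rw [eventually_all]
          intro i
          by_cases hi : i ∈ J
          · have : w i < s i := (hsJ ▸ hi : i ∈ {i | w i < s i})
            filter_upwards [(continuous_apply i).continuousAt ((isOpen_Iio (s i)).mem_nhds this)]
              with t ht _ using ht
          · exact Eventually.of_forall fun _ h => absurd h hi
        filter_upwards [eventually_ge_pi w, hlt] with t ht htJ htT hJ
        refine absurd ?_ (hWF.not_lt_min h (show t ∈ TJ from ⟨htT, ht, hJ⟩))
        refine Pi.lt_def.2 ⟨fun i => ?_, j, htJ j hj⟩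
        by_cases hi : i ∈ J
        · exact (htJ i hi).le
        · have : t i = w i := le_antisymm (not_lt.1 fun h => hi (hJ ▸ h)) (ht i)
          exact this ▸ hws i
  filter_upwards [eventually_all.2 key] with t ht htT using ht _ htT rfl

end FinitePower

end SorgenfreyLine

open SorgenfreyLine

/-! ### Covering the fibres over minimal points -/

section Zorn

variable {X : Type*} [TopologicalSpace X] {φ : X → Set X} {ι : Type*} [Finite ι]
  {p : X → ι → SorgenfreyLine}

/-- If all fibres in `G` of a map to a finite power of the Sorgenfrey line are coverable, then a
closed discrete `D ⊆ G` can be chosen so that, with `Y` the image of the points of `A ∩ G` that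
are not covered by `D`, the fibre over every minimal point of the closure of `Y` is covered. One
fibre over such a point is dealt with at a time, transfinitely; since a later fibre never lies
over a point below that of an earlier one, the fibres used lie over a well-founded set, and so no
accumulation point arises. -/
theorem exists_cover_fibres_minimal (hp : Continuous p) (G A : Set X)
    (hP : ∀ z, Coverable φ (G ∩ p ⁻¹' {z})) :
    ∃ D ⊆ G, HasNoAcc D ∧ ∀ z ∈ closure (p '' ((A ∩ G) \ cov φ D)),
      (∀ z' ∈ closure (p '' ((A ∩ G) \ cov φ D)), ¬ z' < z) → G ∩ p ⁻¹' {z} ⊆ cov φ D := by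
  let C : Set X → Set (ι → SorgenfreyLine) := fun D => closure (p '' ((A ∩ G) \ cov φ D))
  have hC : ∀ {D E : Set X}, D ⊆ E → C E ⊆ C D := fun h =>
    closure_mono (image_mono (sdiff_subset_sdiff_right (cov_mono h)))
  let V := {D : Set X // D ⊆ G ∧ (∀ z, HasNoAcc (D ∩ p ⁻¹' {z})) ∧ (p '' D).IsWF ∧
    ∀ z ∈ C D, ∀ d ∈ D, z ≤ p d → G ∩ p ⁻¹' {z} ⊆ cov φ D}
  let r : V → V → Prop := fun D E => D.1 ⊆ E.1 ∧ ∀ e ∈ E.1, e ∉ D.1 → ∀ d ∈ D.1, ¬ p e ≤ p d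
  have hchain : ∀ c : Set V, IsChain r c → ∃ ub, ∀ a ∈ c, r a ub := by
    intro c hc
    let U : Set X := ⋃ D ∈ c, D.1
    have hU : ∀ {x}, x ∈ U ↔ ∃ D ∈ c, x ∈ D.1 := by simp [U]
    have hend : ∀ D ∈ c, ∀ e ∈ U, e ∉ D.1 → ∀ d ∈ D.1, ¬ p e ≤ p d := by
      intro D hD e he heD
      obtain ⟨E, hE, heE⟩ := hU.1 he
      rcases eq_or_ne D E with rfl | hne
      · exact absurd heE heD
      rcases hc hD hE hne with h | h
      · exact h.2 e heE heD
      · exact absurd (h.1 heE) heD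
    have hsub : ∀ D ∈ c, D.1 ⊆ U := fun D hD x hx => hU.2 ⟨D, hD, hx⟩
    refine ⟨⟨U, ?_, ?_, ?_, ?_⟩, fun D hD => ⟨hsub D hD, hend D hD⟩⟩
    · exact iUnion₂_subset fun D _ => D.2.1
    · intro z
      by_cases h : ∃ d ∈ U, p d = z
      · obtain ⟨d, hd, rfl⟩ := h
        obtain ⟨D, hD, hdD⟩ := hU.1 hd
        refine (D.2.2.1 (p d)).mono ?_
        rintro e ⟨he, hez⟩
        refine ⟨?_, hez⟩
        by_contra heD
        exact hend D hD e he heD d hdD (le_of_eq hez)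
      · refine hasNoAcc_empty.mono ?_
        rintro e ⟨he, hez⟩
        exact h ⟨e, he, hez⟩
    · rw [isWF_iff_no_descending_seq]
      intro f hf hfU
      obtain ⟨d, hd, hdf⟩ := hfU 0
      obtain ⟨D, hD, hdD⟩ := hU.1 hd
      refine (isWF_iff_no_descending_seq.1 D.2.2.2.1) f hf fun n => ?_
      obtain ⟨e, he, hef⟩ := hfU n
      refine ⟨e, ?_, hef⟩
      by_contra heD
      refine hend D hD e he heD d hdD ?_
      rw [hef, hdf]
      exact hf.antitone (Nat.zero_le n)
    · intro z hz d hd hzd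
      obtain ⟨D, hD, hdD⟩ := hU.1 hd
      exact (D.2.2.2.2 z (hC (hsub D hD) hz) d hdD hzd).trans (cov_mono (hsub D hD))
  have htrans : ∀ {a b c : V}, r a b → r b c → r a c := by
    intro a b c hab hbc
    refine ⟨hab.1.trans hbc.1, fun e he hea d hd => ?_⟩
    by_cases heb : e ∈ b.1
    · exact hab.2 e heb hea d hd
    · exact hbc.2 e he heb d (hab.1 hd)
  obtain ⟨⟨D, hDG, hDf, hDW, hDC⟩, hmax⟩ := exists_maximal_of_chains_bounded hchain htrans
  refine ⟨D, hDG, HasNoAcc.of_fibres hp (hasNoAcc_of_isWF hDW)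
    (fun d hd => mem_image_of_mem p hd) hDf, ?_⟩
  intro z hz hzmin
  by_contra hnot
  obtain ⟨E, hEG, hE, hcE⟩ := hP z
  have hnew : ∀ d ∈ D, ¬ z ≤ p d := fun d hd h => hnot (hDC z hz d hd h)
  have hEz : ∀ e ∈ E, p e = z := fun e he => (hEG he).2
  have hV : D ∪ E ⊆ G ∧ (∀ z, HasNoAcc ((D ∪ E) ∩ p ⁻¹' {z})) ∧ (p '' (D ∪ E)).IsWF ∧
      ∀ z ∈ C (D ∪ E), ∀ d ∈ D ∪ E, z ≤ p d → G ∩ p ⁻¹' {z} ⊆ cov φ (D ∪ E) := by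
    refine ⟨union_subset hDG (hEG.trans inter_subset_left), fun y => ?_, ?_, ?_⟩
    · refine ((hDf y).union hE).mono ?_
      rintro x ⟨h | h, hy⟩
      exacts [Or.inl ⟨h, hy⟩, Or.inr h]
    · refine (hDW.insert z).mono ?_
      rintro _ ⟨x, h | h, rfl⟩
      exacts [Or.inr ⟨x, h, rfl⟩, Or.inl (hEz x h)]
    · rintro y hy d (hd | hd) hyd
      · exact (hDC y (hC subset_union_left hy) d hd hyd).trans (cov_mono subset_union_left)
      · rw [hEz d hd] at hyd
        rw [hyd.eq_of_not_lt (hzmin y (hC subset_union_left hy))]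
        exact hcE.trans (cov_mono subset_union_right)
  -- the new fibre lies over a point that is below no point used before, so `D ∪ E` extends `D`
  have hED : D ∪ E ⊆ D := by
    refine (hmax ⟨D ∪ E, hV⟩ ⟨subset_union_left, ?_⟩).1
    rintro e (he | he) heD d hd
    · exact absurd he heD
    · rw [hEz e he]
      exact hnew d hd
  exact hnot (hcE.trans (cov_mono (subset_union_right.trans hED)))

end Zorn

/-! ### Points of nearly extremal volume -/

/-- A bounded subset `Y` of a finite power of the Sorgenfrey line has a subset `E` that has points
below all those points of `Y` that strictly exceed another point of `Y` in every coordinate, but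
that only accumulates at minimal points of the closure of `Y`. For every rational point `q`, the
set `E` contains a point of `Y` that spans with `q` a box whose volume is almost the largest
possible one. If `z < w` with `z` in the closure of `Y`, then the points of `E` above `w` span
smaller boxes than `z` does, by a fixed proportion, so that there are only finitely many. -/
theorem exists_subset_finite_above {ι : Type*} [Fintype ι] {Y : Set (ι → SorgenfreyLine)} {b : ℝ}
    (hb : ∀ y ∈ Y, ∀ i, |(y i).toReal| ≤ b) :
    ∃ E ⊆ Y, (∀ y ∈ Y, ∀ z ∈ Y, (∀ i, z i < y i) → ∃ e ∈ E, e ≤ y) ∧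
      ∀ w, (∃ z ∈ closure Y, z < w) → {e ∈ E | w ≤ e}.Finite := by
  classical
  obtain ⟨f, hf⟩ := exists_injective_nat (ι → ℚ)
  let vol : (ι → ℚ) → (ι → SorgenfreyLine) → ℝ := fun q y => ∏ i, ((q i : ℝ) - (y i).toReal)
  let Below : (ι → ℚ) → (ι → SorgenfreyLine) → Prop := fun q y => ∀ i, (y i).toReal < q i
  let Q := {q : ι → ℚ // (∀ i, (q i : ℝ) ≤ b) ∧ ∃ y ∈ Y, Below q y}
  have hpos : ∀ q y, Below q y → 0 < vol q y := fun q y h =>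
    Finset.prod_pos fun i _ => sub_pos.2 (h i)
  -- the error tends to `0` along `Q`, because `f` takes each value at most once
  let η : Q → ℝ := fun q => 1 / ((f q.1 : ℝ) + 1)
  have hη : ∀ q, 0 < η q := fun q => by positivity
  have key : ∀ q : Q, ∃ e ∈ Y, Below q.1 e ∧
      ∀ y ∈ Y, Below q.1 y → vol q.1 y ≤ (1 + η q) * vol q.1 e := by
    intro q
    obtain ⟨y₀, hy₀, hq₀⟩ := q.2.2
    let s : Set ℝ := vol q.1 '' {y ∈ Y | Below q.1 y}
    have hs : s.Nonempty := ⟨_, y₀, ⟨hy₀, hq₀⟩, rfl⟩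
    have hbdd : BddAbove s := by
      refine ⟨∏ i, ((q.1 i : ℝ) + b), ?_⟩
      rintro _ ⟨y, ⟨hy, hq⟩, rfl⟩
      refine Finset.prod_le_prod (fun i _ => (sub_pos.2 (hq i)).le) fun i _ => ?_
      linarith [(abs_le.1 (hb y hy i)).1]
    have hsup : 0 < sSup s := (hpos _ _ hq₀).trans_le (le_csSup hbdd ⟨y₀, ⟨hy₀, hq₀⟩, rfl⟩)
    have hlt : sSup s / (1 + η q) < sSup s := by
      rw [div_lt_iff₀ (by linarith [hη q])]
      nlinarith [hη q]
    obtain ⟨_, ⟨e, ⟨he, hqe⟩, rfl⟩, hve⟩ := exists_lt_of_lt_csSup hs hlt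
    refine ⟨e, he, hqe, fun y hy hqy => ?_⟩
    have h1 : vol q.1 y ≤ sSup s := le_csSup hbdd ⟨y, ⟨hy, hqy⟩, rfl⟩
    rw [div_lt_iff₀ (by linarith [hη q])] at hve
    linarith
  choose e heY heq hvol using key
  refine ⟨range e, range_subset_iff.2 heY, ?_, ?_⟩
  · intro y hy z hz hzy
    have : ∀ i, ∃ q : ℚ, (z i).toReal < q ∧ (q : ℝ) < (y i).toReal := fun i =>
      exists_rat_btwn (toReal_lt.2 (hzy i))
    choose q hzq hqy using this
    have hq : (∀ i, (q i : ℝ) ≤ b) ∧ ∃ y ∈ Y, Below q y :=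
      ⟨fun i => (hqy i).le.trans (abs_le.1 (hb y hy i)).2, z, hz, hzq⟩
    exact ⟨_, mem_range_self ⟨q, hq⟩, fun i => toReal_le.1 ((heq ⟨q, hq⟩ i).trans (hqy i)).le⟩
  · rintro w ⟨z, hz, hzw⟩
    obtain ⟨hzw', i, hi⟩ := Pi.lt_def.1 hzw
    have hcoord : ∀ i, Continuous fun y : ι → SorgenfreyLine => (y i).toReal := fun i =>
      continuous_toReal.comp (continuous_apply i)
    have hcont : ∀ q, Continuous (vol q) := fun q =>
      continuous_finsetProd _ fun i _ => continuous_const.sub (hcoord i)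
    have hcl : ∀ q : Q, Below q.1 z → vol q.1 z ≤ (1 + η q) * vol q.1 (e q) := by
      intro q hq
      by_contra! hlt
      have ho : ∀ᶠ y in 𝓝 z, (∀ i, (y i).toReal < (q.1 i : ℝ)) ∧
          (1 + η q) * vol q.1 (e q) < vol q.1 y :=
        (eventually_all.2 fun i => (hcoord i).continuousAt.eventually (gt_mem_nhds (hq i))).and
          ((hcont q.1).continuousAt.eventually (lt_mem_nhds hlt))
      obtain ⟨y, ⟨h1, h2⟩, hy⟩ := mem_closure_iff_nhds.1 hz _ ho
      exact absurd (hvol q y hy h1) h2.not_ge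
    -- comparing the volumes at `z` and `w`, and cancelling all factors but the `i`-th bounds `f q`
    have hbound : ∀ q : Q, w ≤ e q →
        ((f q.1 : ℝ) + 1) * ((w i).toReal - (z i).toReal) ≤ b - (w i).toReal := by
      intro q hwe
      have hqw : Below q.1 w := fun j => (toReal_le.2 (hwe j)).trans_lt (heq q j)
      have hqz : Below q.1 z := fun j => (toReal_le.2 (hzw' j)).trans_lt (hqw j)
      have h1 : vol q.1 (e q) ≤ vol q.1 w :=
        Finset.prod_le_prod (fun j _ => (sub_pos.2 (heq q j)).le) fun j _ =>
          sub_le_sub_left (toReal_le.2 (hwe j)) _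
      let P : ℝ := ∏ j ∈ Finset.univ.erase i, ((q.1 j : ℝ) - (w j).toReal)
      have hP : 0 < P := Finset.prod_pos fun j _ => sub_pos.2 (hqw j)
      have h2 : vol q.1 w = ((q.1 i : ℝ) - (w i).toReal) * P :=
        (Finset.mul_prod_erase _ _ (Finset.mem_univ i)).symm
      have h3 : ((q.1 i : ℝ) - (z i).toReal) * P ≤ vol q.1 z := by
        have : vol q.1 z = ((q.1 i : ℝ) - (z i).toReal) *
            ∏ j ∈ Finset.univ.erase i, ((q.1 j : ℝ) - (z j).toReal) :=
          (Finset.mul_prod_erase _ _ (Finset.mem_univ i)).symm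
        rw [this]
        refine mul_le_mul_of_nonneg_left ?_ (sub_pos.2 (hqz i)).le
        exact Finset.prod_le_prod (fun j _ => (sub_pos.2 (hqw j)).le) fun j _ =>
          sub_le_sub_left (toReal_le.2 (hzw' j)) _
      have h4 : ((q.1 i : ℝ) - (z i).toReal) * P ≤
          ((1 + η q) * ((q.1 i : ℝ) - (w i).toReal)) * P := by
        calc _ ≤ vol q.1 z := h3
          _ ≤ (1 + η q) * vol q.1 (e q) := hcl q hqz
          _ ≤ (1 + η q) * vol q.1 w := by have := hη q; gcongr
          _ = _ := by rw [h2]; ring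
      have h5 := le_of_mul_le_mul_right h4 hP
      have h6 : ((f q.1 : ℝ) + 1) * η q = 1 := mul_one_div_cancel (by positivity)
      have h7 : (w i).toReal - (z i).toReal ≤ η q * (b - (w i).toReal) := by
        have := mul_le_mul_of_nonneg_left (sub_le_sub_right (q.2.1 i) (w i).toReal) (hη q).le
        linarith
      calc _ ≤ ((f q.1 : ℝ) + 1) * (η q * (b - (w i).toReal)) := by gcongr
        _ = _ := by rw [← mul_assoc, h6, one_mul]
    have hd : 0 < (w i).toReal - (z i).toReal := sub_pos.2 (toReal_lt.2 hi)
    obtain ⟨M, hM⟩ := exists_nat_ge ((b - (w i).toReal) / ((w i).toReal - (z i).toReal))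
    have hfin : {q : Q | f q.1 ≤ M}.Finite :=
      (finite_Iic M).preimage (f := fun q : Q => f q.1)
        (hf.comp Subtype.val_injective).injOn
    refine (hfin.image e).subset ?_
    rintro _ ⟨⟨q, rfl⟩, hwe⟩
    refine ⟨q, ?_, rfl⟩
    have := (le_div_iff₀ hd).2 (hbound q hwe)
    have : (f q.1 : ℝ) ≤ M := by linarith
    exact_mod_cast this

/-! ### Cones are thin -/

section Core

variable {φ : (ℕ → SorgenfreyLine) → Set (ℕ → SorgenfreyLine)}

/-- One move in a closed set `H` whose fibres over the coordinates in `K` are coverable: a closed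
discrete subset of `H` such that of two points of `A ∩ H` that are not covered, neither strictly
exceeds the other in all the coordinates in `K`. -/
theorem exists_cover_no_strict_pair {A H : Set (ℕ → SorgenfreyLine)}
    (hφ : IsNeighbourhoodAssignment φ) {K : Finset ℕ} {b : ℝ} (hH : IsClosed H)
    (hcone : ∀ x ∈ A ∩ H, ∀ y ∈ A ∩ H, (∀ i ∈ K, x i ≤ y i) → y ∈ φ x)
    (hb : ∀ x ∈ A, ∀ i ∈ K, |(x i).toReal| ≤ b)
    (hP : ∀ z : K → SorgenfreyLine,
      Coverable φ (H ∩ (fun (x : ℕ → SorgenfreyLine) (i : K) => x i) ⁻¹' {z})) :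
    ∃ D ⊆ H, HasNoAcc D ∧ ∀ x ∈ (A ∩ H) \ cov φ D, ∀ y ∈ (A ∩ H) \ cov φ D,
      ¬ ∀ i ∈ K, x i < y i := by
  let p : (ℕ → SorgenfreyLine) → K → SorgenfreyLine := fun x i => x i
  have hp : Continuous p := continuous_pi fun i => continuous_apply _
  obtain ⟨D₁, hD₁H, hD₁, hmin⟩ := exists_cover_fibres_minimal hp H A hP
  set R := (A ∩ H) \ cov φ D₁
  obtain ⟨E, hEY, hEcov, hEfin⟩ := exists_subset_finite_above (Y := p '' R) (b := b) (by
    rintro _ ⟨x, hx, rfl⟩ i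
    exact hb x hx.1.1 i i.2)
  have : Nonempty SorgenfreyLine := (exists_toReal 0).nonempty
  have hlift : ∀ e ∈ E, ∃ x ∈ R, p x = e := fun e he => hEY he
  choose! d hdR hdp using hlift
  have hD₂R : d '' E ⊆ R := by
    rintro _ ⟨e, he, rfl⟩
    exact hdR e he
  have hD₂ : HasNoAcc (d '' E) := by
    intro x
    by_cases hxH : x ∈ H
    swap
    · filter_upwards [hH.isOpen_compl.mem_nhds hxH] with y h1 hy
      exact absurd (hD₂R hy).1.2 h1
    by_cases hxD : x ∈ cov φ D₁
    · filter_upwards [(isOpen_cov hφ D₁).mem_nhds hxD] with y h1 hy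
      exact absurd h1 (hD₂R hy).2
    by_cases hxC : p x ∈ closure (p '' R)
    swap
    · filter_upwards [hp.continuousAt (isClosed_closure.isOpen_compl.mem_nhds hxC)] with y h1 hy
      exact absurd (subset_closure (mem_image_of_mem p (hD₂R hy))) h1
    -- the fibre of `x` is not covered, so `p x` is not minimal
    have : ∃ z ∈ closure (p '' R), z < p x := by
      by_contra! h
      exact hxD (hmin _ hxC h ⟨hxH, rfl⟩)
    filter_upwards [hp.continuousAt (eventually_ge_pi (p x)),
      hasNoAcc_finite ((hEfin _ this).image d) x] with y h1 h2 hy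
    obtain ⟨e, he, rfl⟩ := hy
    refine h2 ⟨e, ⟨he, ?_⟩, rfl⟩
    rw [← hdp e he]
    exact h1
  refine ⟨D₁ ∪ d '' E, union_subset hD₁H (hD₂R.trans fun x hx => hx.1.2), hD₁.union hD₂, ?_⟩
  rintro x ⟨hx, hxD⟩ y ⟨hy, hyD⟩ hxy
  have hmem : ∀ {z}, z ∈ A ∩ H → z ∉ cov φ (D₁ ∪ d '' E) → z ∈ R := fun h1 h2 =>
    ⟨h1, fun h => h2 (cov_mono subset_union_left h)⟩
  obtain ⟨e, he, hey⟩ := hEcov (p y) ⟨y, hmem hy hyD, rfl⟩ (p x) ⟨x, hmem hx hxD, rfl⟩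
    fun i => hxy i i.2
  refine hyD (mem_cov.2 ⟨d e, Or.inr ⟨e, he, rfl⟩, hcone _ (hdR e he).1 _ hy fun i hi => ?_⟩)
  rw [← hdp e he] at hey
  exact hey ⟨i, hi⟩

/-- Let `φ x` contain all those points of `A` that are above `x ∈ A` in the coordinates in `N`. If
the fibres in `G` over these coordinates are coverable, then `A ∩ G` is thin. The proof is by
induction on the number of coordinates in `N` that are not constant on `G`. -/
theorem thin_of_cone {A : Set (ℕ → SorgenfreyLine)} (hφ : IsNeighbourhoodAssignment φ)
    {N : Finset ℕ} {b : ℝ} (hcone : ∀ x ∈ A, ∀ y ∈ A, (∀ i ∈ N, x i ≤ y i) → y ∈ φ x)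
    (hb : ∀ x ∈ A, ∀ i ∈ N, |(x i).toReal| ≤ b) (k : ℕ) {K : Finset ℕ} (hKN : K ⊆ N)
    (hK : K.card = k) {G : Set (ℕ → SorgenfreyLine)} (hG : IsClosed G)
    (hGK : ∀ x ∈ G, ∀ y ∈ G, ∀ i ∈ N, i ∉ K → x i = y i)
    (hP : ∀ G' ⊆ G, IsClosed G' → (∀ x ∈ G', ∀ y ∈ G', ∀ i ∈ N, x i = y i) → Coverable φ G') :
    Thin φ (k + 1) (A ∩ G) := by
  induction k generalizing K G with
  | zero =>
    rw [Finset.card_eq_zero] at hK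
    subst hK
    intro F hF
    obtain ⟨D, hDF, hD, hc⟩ := hP (G ∩ F) inter_subset_left (hG.inter hF)
      fun x hx y hy i hi => hGK x hx.1 y hy.1 i hi (Finset.notMem_empty i)
    exact ⟨D, hDF.trans inter_subset_right, hD, fun _ => ∅, fun _ => thin_empty 0,
      fun x hx => Or.inl (hc ⟨hx.1.2, hx.2⟩)⟩
  | succ k ih =>
    refine thin_succ_of_countable fun F hF => ?_
    obtain ⟨D, hDH, hD, hpair⟩ := exists_cover_no_strict_pair (A := A) hφ (K := K) (hG.inter hF)
      (fun x hx y hy h => hcone x hx.1 y hy.1 fun i hi =>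
        if hiK : i ∈ K then h i hiK else (hGK x hx.2.1 y hy.2.1 i hi hiK).le)
      (fun x hx i hi => hb x hx i (hKN hi))
      (fun z => by
        refine hP _ (inter_subset_left.trans inter_subset_left) ((hG.inter hF).inter
          (isClosed_singleton.preimage (continuous_pi fun i => continuous_apply _))) ?_
        rintro x ⟨hx, hxz⟩ y ⟨hy, hyz⟩ i hi
        by_cases hiK : i ∈ K
        · exact (congrFun hxz ⟨i, hiK⟩).trans (congrFun hyz ⟨i, hiK⟩).symm
        · exact hGK x hx.1 y hy.1 i hi hiK)
    set R := (A ∩ (G ∩ F)) \ cov φ D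
    -- `Over J x`: some uncovered point agrees with `x` on `J` and is smaller on the rest of `K`
    let Over : Finset K → (ℕ → SorgenfreyLine) → Prop := fun J x =>
      ∃ z ∈ R, (∀ i ∈ J, z i = x i) ∧ ∀ i ∉ J, z i < x i
    let B : Finset K × (K → ℚ) → Set (ℕ → SorgenfreyLine) := fun t =>
      {x ∈ R | (∃ z ∈ R, (∀ i ∈ t.1, z i = x i) ∧
        ∀ i ∉ t.1, (z i).toReal < t.2 i ∧ (t.2 i : ℝ) < (x i).toReal) ∧ ∀ J < t.1, ¬ Over J x}
    refine ⟨D, hDH.trans inter_subset_right, hD, _, inferInstance, B, ?_, ?_⟩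
    · rintro ⟨J, q⟩
      rcases J.eq_empty_or_nonempty with rfl | ⟨j, hj⟩
      · refine (thin_empty (k + 1)).mono ?_
        rintro x ⟨hx, ⟨z, hz, -, hzx⟩, -⟩
        refine hpair z hz x hx fun i hi => ?_
        have := hzx ⟨i, hi⟩ (Finset.notMem_empty _)
        exact toReal_lt.1 (this.1.trans this.2)
      · let p : (ℕ → SorgenfreyLine) → J → SorgenfreyLine := fun x i => x i.1
        have hp : Continuous p := continuous_pi fun i => continuous_apply _
        -- minimality of `J` makes the projection of `B (J, q)` to `J` an antichain
        have hanti : ∀ x ∈ B (J, q), ∀ y ∈ B (J, q), ¬ p x < p y := by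
          rintro x ⟨-, ⟨z, hz, hzJ, hzq⟩, -⟩ y ⟨-, ⟨z', -, -, hz'q⟩, hymin⟩ hxy
          obtain ⟨hle, i₀, hi₀⟩ := Pi.lt_def.1 hxy
          refine hymin (J.filter fun i => x i = y i) ?_ ⟨z, hz, ?_, ?_⟩
          · refine Finset.filter_ssubset.2 ⟨i₀.1, i₀.2, ?_⟩
            exact ne_of_lt hi₀
          · intro i hi
            rw [Finset.mem_filter] at hi
            rw [hzJ i hi.1, hi.2]
          · intro i hi
            rw [Finset.mem_filter, not_and] at hi
            by_cases hiJ : i ∈ J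
            · rw [hzJ i hiJ]
              exact lt_of_le_of_ne (hle ⟨i, hiJ⟩) (hi hiJ)
            · exact toReal_lt.1 ((hzq i hiJ).1.trans (hz'q i hiJ).2)
        have hWF : (p '' B (J, q)).IsWF := by
          rw [isWF_iff_no_descending_seq]
          intro f hf hfB
          obtain ⟨x, hx, hx0⟩ := hfB 0
          obtain ⟨y, hy, hy1⟩ := hfB 1
          refine hanti y hy x hx ?_
          rw [hx0, hy1]
          exact hf Nat.zero_lt_one
        refine Thin.of_fibres hp (hasNoAcc_of_isWF hWF) (fun x hx => mem_image_of_mem p hx)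
          fun t => ?_
        have hslice : IsClosed (G ∩ (fun x : ℕ → SorgenfreyLine => x j) ⁻¹' {t ⟨j, hj⟩}) :=
          hG.inter (isClosed_singleton.preimage (continuous_apply _))
        refine (ih (K := K.erase j) ((Finset.erase_subset _ _).trans hKN) ?_ hslice ?_ ?_).mono
          (A' := B (J, q) ∩ p ⁻¹' {t}) ?_
        · rw [Finset.card_erase_of_mem j.2, hK, Nat.add_sub_cancel]
        · rintro x ⟨hx, hxt⟩ y ⟨hy, hyt⟩ i hi hiK
          by_cases hij : i = j
          · rw [hij]
            exact hxt.trans hyt.symm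
          · exact hGK x hx y hy i hi fun h => hiK (Finset.mem_erase.2 ⟨hij, h⟩)
        · exact fun G' hG' => hP G' (hG'.trans inter_subset_left)
        · rintro x ⟨hx, hxt⟩
          exact ⟨hx.1.1.1, hx.1.1.2.1, congrFun hxt ⟨j, hj⟩⟩
    · rintro x ⟨⟨hxA, hxG⟩, hxF⟩
      by_cases hxD : x ∈ cov φ D
      · exact Or.inl hxD
      · have hxR : x ∈ R := ⟨⟨hxA, hxG, hxF⟩, hxD⟩
        have hne : {J | Over J x}.Nonempty :=
          ⟨Finset.univ, x, hxR, fun _ _ => rfl, fun i hi => absurd (Finset.mem_univ i) hi⟩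
        obtain ⟨J, ⟨z, hz, hzJ, hzx⟩, hJmin⟩ := wellFounded_lt.has_min _ hne
        have : ∀ i : K, ∃ q : ℚ, i ∉ J → (z i).toReal < q ∧ (q : ℝ) < (x i).toReal := by
          intro i
          by_cases hi : i ∈ J
          · exact ⟨0, fun h => absurd hi h⟩
          · exact (exists_rat_btwn (toReal_lt.2 (hzx i hi))).imp fun q hq _ => hq
        choose q hq using this
        exact Or.inr (mem_iUnion.2 ⟨(J, q), hxR, ⟨z, hz, hzJ, hq⟩, fun J' h h' => hJmin J' h' h⟩)

/-! ### Descent to a point -/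

/-- A closed set that is not coverable contains one on which the first `m` coordinates are
constant. -/
theorem exists_not_coverable_subset (hφ : IsNeighbourhoodAssignment φ)
    {F : Set (ℕ → SorgenfreyLine)} (hF : IsClosed F) (hnot : ¬ Coverable φ F) (m : ℕ) :
    ∃ F' ⊆ F, IsClosed F' ∧ ¬ Coverable φ F' ∧ ∀ x ∈ F', ∀ y ∈ F', ∀ i < m, x i = y i := by
  by_contra! hall
  have hP : ∀ G ⊆ F, IsClosed G → (∀ x ∈ G, ∀ y ∈ G, ∀ i < m, x i = y i) → Coverable φ G := by
    intro G hGF hG hGm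
    by_contra h
    obtain ⟨x, hx, y, hy, i, hi, hne⟩ := hall G hGF hG h
    exact hne (hGm x hx y hy i hi)
  -- the points where `φ` contains a box of side `1 / (m + n + 1)` in the first `m + n`
  -- coordinates, sorted by the cell of the grid of that width
  let A : (Σ n : ℕ, Fin (m + n) → ℤ) → Set (ℕ → SorgenfreyLine) := fun t =>
    {x | (∀ y : ℕ → SorgenfreyLine, (∀ i < m + t.1, x i ≤ y i ∧
        (y i).toReal < (x i).toReal + 1 / ((m + t.1 : ℕ) + 1)) → y ∈ φ x) ∧
      ∀ i : Fin (m + t.1), ⌊(x i).toReal * ((m + t.1 : ℕ) + 1)⌋ = t.2 i}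
  have hthin : ∀ t, Thin φ (m + t.1 + 1) (A t ∩ F) := by
    rintro ⟨n, c⟩
    have hN : (1 : ℝ) ≤ ((m + n : ℕ) : ℝ) + 1 := le_add_of_nonneg_left (Nat.cast_nonneg _)
    refine thin_of_cone (b := ∑ i, (|(c i : ℝ)| + 1)) hφ (N := Finset.range (m + n)) ?_ ?_ (m + n)
      Finset.Subset.rfl (Finset.card_range _) hF (fun _ _ _ _ i h1 h2 => absurd h1 h2) ?_
    · rintro x ⟨hx, hxc⟩ y ⟨-, hyc⟩ hxy
      refine hx y fun i hi => ⟨hxy i (Finset.mem_range.2 hi), ?_⟩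
      have h1 := Int.floor_le ((x i).toReal * (((m + n : ℕ) : ℝ) + 1))
      have h2 := Int.lt_floor_add_one ((y i).toReal * (((m + n : ℕ) : ℝ) + 1))
      rw [hxc ⟨i, hi⟩] at h1
      rw [hyc ⟨i, hi⟩] at h2
      have h3 : (y i).toReal * (((m + n : ℕ) : ℝ) + 1) <
          ((x i).toReal + 1 / (((m + n : ℕ) : ℝ) + 1)) * (((m + n : ℕ) : ℝ) + 1) := by
        rw [add_mul, one_div, inv_mul_cancel₀ (by positivity)]
        linarith
      exact lt_of_mul_lt_mul_right h3 (by positivity)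
    · rintro x ⟨-, hxc⟩ i hi
      rw [Finset.mem_range] at hi
      have h1 := Int.floor_le ((x i).toReal * (((m + n : ℕ) : ℝ) + 1))
      have h2 := Int.lt_floor_add_one ((x i).toReal * (((m + n : ℕ) : ℝ) + 1))
      rw [hxc ⟨i, hi⟩] at h1 h2
      have h3 : |(x i).toReal * (((m + n : ℕ) : ℝ) + 1)| ≤ |(c ⟨i, hi⟩ : ℝ)| + 1 :=
        abs_le.2 ⟨by linarith [neg_abs_le (c ⟨i, hi⟩ : ℝ)],
          by linarith [le_abs_self (c ⟨i, hi⟩ : ℝ)]⟩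
      rw [abs_mul, abs_of_pos (by positivity : (0 : ℝ) < ((m + n : ℕ) : ℝ) + 1)] at h3
      calc |(x i).toReal| ≤ |(x i).toReal| * (((m + n : ℕ) : ℝ) + 1) :=
            le_mul_of_one_le_right (abs_nonneg _) hN
        _ ≤ |(c ⟨i, hi⟩ : ℝ)| + 1 := h3
        _ ≤ _ := Finset.single_le_sum (f := fun i => |(c i : ℝ)| + 1)
            (fun _ _ => by positivity) (Finset.mem_univ _)
    · exact fun G hGF hG hGN => hP G hGF hG fun x hx y hy i hi =>
        hGN x hx y hy i (Finset.mem_range.2 (by omega))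
  have : Nonempty (Σ n : ℕ, Fin (m + n) → ℤ) := ⟨⟨0, fun _ => 0⟩⟩
  obtain ⟨f, hf⟩ := exists_surjective_nat (Σ n : ℕ, Fin (m + n) → ℤ)
  refine hnot (coverable_of_thin hφ hF (fun k => hthin (f k)) fun x hx => ?_)
  obtain ⟨n, hn⟩ := exists_box_subset ((hφ x).1.mem_nhds (hφ x).2)
  obtain ⟨k, hk⟩ := hf ⟨n, fun i => ⌊(x i).toReal * (((m + n : ℕ) : ℝ) + 1)⌋⟩
  refine mem_iUnion.2 ⟨k, ?_, hx⟩
  rw [hk]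
  refine ⟨fun y hy => hn y fun i hi => ?_, fun i => rfl⟩
  obtain ⟨h1, h2⟩ := hy i (by simp only; omega)
  refine ⟨h1, h2.trans_le ?_⟩
  have : (n : ℝ) ≤ ((m + n : ℕ) : ℝ) := Nat.cast_le.2 (Nat.le_add_left n m)
  gcongr

/-- Otherwise there would be a decreasing sequence of closed sets that are not coverable, the
`k`-th of which fixes the first `k` coordinates. It shrinks to a point `p` of all these sets, and
the single neighbourhood `φ p` covers one of them. -/
theorem coverable_univ (hφ : IsNeighbourhoodAssignment φ) : Coverable φ univ := by
  by_contra hnot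
  let T := {F : Set (ℕ → SorgenfreyLine) // IsClosed F ∧ ¬ Coverable φ F}
  have key : ∀ (t : T) (m : ℕ), ∃ s : T, s.1 ⊆ t.1 ∧ ∀ x ∈ s.1, ∀ y ∈ s.1, ∀ i < m, x i = y i := by
    rintro ⟨F, hF, h⟩ m
    obtain ⟨F', h1, h2, h3, h4⟩ := exists_not_coverable_subset hφ hF h m
    exact ⟨⟨F', h2, h3⟩, h1, h4⟩
  choose next hsub hconst using key
  let S : ℕ → T := fun k => Nat.rec ⟨univ, isClosed_univ, hnot⟩ (fun k t => next t (k + 1)) k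
  have hanti : ∀ {j k}, j ≤ k → (S k).1 ⊆ (S j).1 := by
    intro j k h
    induction h with
    | refl => exact subset_rfl
    | step _ ih => exact (hsub _ _).trans ih
  have hne : ∀ k, ∃ x, x ∈ (S k).1 := by
    intro k
    by_contra! h
    exact (S k).2.2 ⟨∅, empty_subset _, hasNoAcc_empty, fun x hx => absurd hx (h x)⟩
  choose pt hpt using hne
  let p : ℕ → SorgenfreyLine := fun i => pt (i + 1) i
  have hp : ∀ {i k}, i < k → ∀ x ∈ (S k).1, x i = p i := fun {i k} hik x hx =>
    hconst (S i) (i + 1) x (hanti hik hx) _ (hpt (i + 1)) i (Nat.lt_succ_self i)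
  have hbox : ∀ U ∈ 𝓝 p, ∃ n, (S n).1 ⊆ U := by
    intro U hU
    obtain ⟨n, hn⟩ := exists_box_subset hU
    refine ⟨n, fun x hx => hn x fun i hi => ?_⟩
    rw [hp hi x hx]
    exact ⟨le_rfl, lt_add_of_pos_right _ (by positivity)⟩
  have hpS : ∀ k, p ∈ (S k).1 := by
    intro k
    by_contra h
    obtain ⟨n, hn⟩ := hbox _ ((S k).2.1.isOpen_compl.mem_nhds h)
    exact hn (hanti (le_max_right k n) (hpt _)) (hanti (le_max_left k n) (hpt _))
  obtain ⟨n, hn⟩ := hbox _ ((hφ p).1.mem_nhds (hφ p).2)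
  exact (S n).2.2 ⟨{p}, singleton_subset_iff.2 (hpS n), hasNoAcc_finite (finite_singleton p),
    fun x hx => mem_cov.2 ⟨p, rfl, hn hx⟩⟩

end Core

/-- The countable power of the Sorgenfrey line, with the product topology, is a D-space. -/
theorem mainTheorem1 : IsDSpace (ℕ → SorgenfreyLine) := by
  intro φ hφ
  obtain ⟨D, -, hD, hc⟩ := coverable_univ hφ
  exact ⟨D, hD.isClosed, hD.isDiscrete, univ_subset_iff.1 hc⟩
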